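/- **Theorem.** The following problem is undecidable. *Given a DL-Lite$_{\text{core}}$ ontology $\mathcal O$ and a finite union $\Phi$ of Boolean conjunctive queries with safe negation: does $\mathcal O\models\Phi$?* This holds whether or not the Partial Closed World Assumption is adopted, and whether or not the Unique Name Assumption is adopted (so in each of the four cases no algorithm answers the question correctly on all such inputs). Here a DL-Lite$_{\text{core}}$ ontology consists of finitely many inclusions $B\sqsubseteq C$ and $B\sqsubseteq\neg C$, where $B$ and $C$ are basic concepts, that is, of the form $A$, $\exists P$ or $\exists P^{-}$ for a unary symbol $A$ and a binary symbol $P$, and of finitely many assertions $A(a)$, $P(a,b)$ with constants $a,b$. A Boolean conjunctive query with safe negation is the existential closure of a finite conjunction of atoms $A(x)$, $P(x,y)$ and negated atoms $\neg A(x)$, $\neg P(x,y)$, with variables $x,y$, in which every variable of a negated atom also occurs in a non-negated atom. $\mathcal O\models\Phi$ means that at least one of the queries of $\Phi$ is true in every (finite or infinite) model of $\mathcal O$, where the query may depend on the model. A model of $\mathcal O$ is a nonempty relational structure, with an interpretation of the constants, in which all inclusions and assertions of $\mathcal O$ are true. Under the Unique Name Assumption it must in addition interpret different constants of $\mathcal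 O$ as different elements; under the Partial Closed World Assumption, every fact $A(a)$ or $P(a,b)$ that is true in it and involves only constants of $\mathcal O$ must be an assertion of $\mathcal O$. -/

import Mathlib

namespace DLLite

/-! Concept names, role names, individual names (constants) and query variables are all drawn
from countably infinite supplies, represented by `ℕ`. -/

/-- A role `P` or an inverse role `P⁻`, for a role name `P`. -/
inductive Role where
  | name (P : ℕ)
  | inv (P : ℕ)

/-- A basic concept: a concept name `A`, or `∃R` for a role `R`. -/
inductive Basic where
  | name (A : ℕ)
  | ex (R : Role)

/-- The inclusions of DL-Lite_core: `B ⊑ C` and `B ⊑ ¬C`, for basic concepts `B`, `C`. -/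
inductive Inclusion where
  | sub (B C : Basic)
  | disj (B C : Basic)

/-- An atom `A(t)` or `P(t, u)`. The terms `t`, `u` are individual names when the atom is an
assertion of an ontology, and variables when it occurs in a query. -/
inductive Atom where
  | unary (A t : ℕ)
  | binary (P t u : ℕ)

/-- The terms that occur in an atom. -/
def Atom.terms : Atom → List ℕ
  | .unary _ t => [t]
  | .binary _ t u => [t, u]

/-- A DL-Lite_core ontology: finitely many inclusions and finitely many assertions. -/
structure Ontology where
  tbox : List Inclusion
  abox : List Atom

/-- `c` is one of the constants that occur in the ontology. -/
def Ontology.Mentions (O : Ontology) (c : ℕ) : Prop :=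
  ∃ α ∈ O.abox, c ∈ α.terms

/-- The existential closure of the conjunction of the atoms in `pos` and of the negations of the
atoms in `neg`; the terms of the atoms are variables. -/
structure CQ where
  pos : List Atom
  neg : List Atom

/-- The negation is safe: each variable of a negated atom also occurs in a positive atom. -/
def CQ.Safe (q : CQ) : Prop :=
  ∀ α ∈ q.neg, ∀ x ∈ α.terms, ∃ β ∈ q.pos, x ∈ β.terms

/-- A finite union (disjunction) of Boolean conjunctive queries with negation. -/
abbrev UCQ : Type := List CQ

/-- Each disjunct is a conjunctive query with safe negation. -/
def UCQ.Safe (Φ : UCQ) : Prop :=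
  ∀ q ∈ Φ, CQ.Safe q

/-! ### Semantics -/

/-- A relational structure, finite or infinite, with an interpretation of the constants
(in particular its domain is not empty). By the downward Löwenheim–Skolem theorem it makes no
difference for entailment in which universe the domains live. -/
structure Interp where
  Dom : Type
  const : ℕ → Dom
  conc : ℕ → Dom → Prop
  rel : ℕ → Dom → Dom → Prop

namespace Interp

/-- The binary relation that interprets a role. -/
def role (D : Interp) : Role → D.Dom → D.Dom → Prop
  | .name P, s, t => D.rel P s t
  | .inv P, s, t => D.rel P t s

/-- The set that interprets a basic concept. -/
def basic (D : Interp) : Basic → D.Dom → Prop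
  | .name A, s => D.conc A s
  | .ex R, s => ∃ t, D.role R s t

/-- The inclusion is true in the structure. -/
def SatInclusion (D : Interp) : Inclusion → Prop
  | .sub B C => ∀ s, D.basic B s → D.basic C s
  | .disj B C => ∀ s, D.basic B s → ¬ D.basic C s

/-- The atom is true in the structure when its terms are evaluated by `v`. -/
def SatAtom (D : Interp) (v : ℕ → D.Dom) : Atom → Prop
  | .unary A t => D.conc A (v t)
  | .binary P t u => D.rel P (v t) (v u)

/-- All inclusions and all assertions of the ontology are true in the structure. -/
def SatOntology (D : Interp) (O : Ontology) : Prop :=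
  (∀ i ∈ O.tbox, D.SatInclusion i) ∧ ∀ α ∈ O.abox, D.SatAtom D.const α

/-- Unique Name Assumption: different constants of the ontology are interpreted as different
elements. -/
def UniqueNames (D : Interp) (O : Ontology) : Prop :=
  ∀ c d, O.Mentions c → O.Mentions d → D.const c = D.const d → c = d

/-- Partial Closed World Assumption: a ground fact that involves only constants of the ontology
is true in the structure only if it is an assertion of the ontology. -/
def PartialClosedWorld (D : Interp) (O : Ontology) : Prop :=
  ∀ α : Atom, (∀ c ∈ α.terms, O.Mentions c) → D.SatAtom D.const α → α ∈ O.abox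

/-- `D` is a model of `O`, where the Unique Name Assumption is imposed if `una = true` and the
Partial Closed World Assumption is imposed if `pcwa = true`. -/
def IsModel (una pcwa : Bool) (D : Interp) (O : Ontology) : Prop :=
  D.SatOntology O ∧ (una = true → D.UniqueNames O) ∧ (pcwa = true → D.PartialClosedWorld O)

/-- The Boolean conjunctive query with negation is true in the structure. -/
def SatCQ (D : Interp) (q : CQ) : Prop :=
  ∃ v : ℕ → D.Dom, (∀ α ∈ q.pos, D.SatAtom v α) ∧ ∀ α ∈ q.neg, ¬ D.SatAtom v α

/-- Some disjunct of the union is true in the structure. -/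
def SatUCQ (D : Interp) (Φ : UCQ) : Prop :=
  ∃ q ∈ Φ, D.SatCQ q

end Interp

/-- The ontology entails the union of conjunctive queries: the latter is true in every model of
the former. -/
def Entails (una pcwa : Bool) (O : Ontology) (Φ : UCQ) : Prop :=
  ∀ D : Interp, D.IsModel una pcwa O → D.SatUCQ Φ

/-! ### Ontologies and queries as inputs of algorithms

The syntactic objects are coded by natural numbers through the obvious bijections with sums,
products and lists of natural numbers. -/

/-- Roles as a sum. -/
def Role.equiv : Role ≃ ℕ ⊕ ℕ where
  toFun | .name P => .inl P | .inv P => .inr P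
  invFun | .inl P => .name P | .inr P => .inv P
  left_inv := by rintro (_ | _) <;> rfl
  right_inv := by rintro (_ | _) <;> rfl

instance : Primcodable Role := Primcodable.ofEquiv _ Role.equiv

/-- Basic concepts as a sum. -/
def Basic.equiv : Basic ≃ ℕ ⊕ Role where
  toFun | .name A => .inl A | .ex R => .inr R
  invFun | .inl A => .name A | .inr R => .ex R
  left_inv := by rintro (_ | _) <;> rfl
  right_inv := by rintro (_ | _) <;> rfl

instance : Primcodable Basic := Primcodable.ofEquiv _ Basic.equiv

/-- Inclusions as a sum. -/
def Inclusion.equiv : Inclusion ≃ (Basic × Basic) ⊕ (Basic × Basic) where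
  toFun | .sub B C => .inl (B, C) | .disj B C => .inr (B, C)
  invFun | .inl (B, C) => .sub B C | .inr (B, C) => .disj B C
  left_inv := by rintro (_ | _) <;> rfl
  right_inv := by rintro (_ | _) <;> rfl

instance : Primcodable Inclusion := Primcodable.ofEquiv _ Inclusion.equiv

/-- Atoms as a sum. -/
def Atom.equiv : Atom ≃ (ℕ × ℕ) ⊕ (ℕ × ℕ × ℕ) where
  toFun | .unary A t => .inl (A, t) | .binary P t u => .inr (P, t, u)
  invFun | .inl (A, t) => .unary A t | .inr (P, t, u) => .binary P t u
  left_inv := by rintro (_ | _) <;> rfl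
  right_inv := by rintro (_ | _) <;> rfl

instance : Primcodable Atom := Primcodable.ofEquiv _ Atom.equiv

/-- Ontologies as pairs. -/
def Ontology.equiv : Ontology ≃ List Inclusion × List Atom where
  toFun O := (O.tbox, O.abox)
  invFun p := ⟨p.1, p.2⟩
  left_inv _ := rfl
  right_inv _ := rfl

instance : Primcodable Ontology := Primcodable.ofEquiv _ Ontology.equiv

/-- Conjunctive queries as pairs. -/
def CQ.equiv : CQ ≃ List Atom × List Atom where
  toFun q := (q.pos, q.neg)
  invFun p := ⟨p.1, p.2⟩
  left_inv _ := rfl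
  right_inv _ := rfl

instance : Primcodable CQ := Primcodable.ofEquiv _ CQ.equiv

end DLLite

/-! The halting problem reduces to entailment. A safe query can say that a Horn rule is violated, so
a union is entailed exactly if its remaining disjunct holds in every model that obeys the rules.
Here the ontology is fixed and forces an infinite successor chain; the rules compute pairing and
evaluation of codes along it, and the remaining disjunct says that `c` has an output at `n`. If `c`
halts, a model obeying the rules contains at least the true facts about the chain (`rel_pair`,
`rel_graphRole`). Spurious facts do no harm, as the halting query is purely positive. If `c` does
not halt, `pointedInterp` refutes every disjunct (`not_satCQ`). The two Assumptions play no role: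
there is one constant, and the chain of `pointedInterp` avoids it. Taking `c` universal leaves `n`
as the only varying datum. -/

namespace DLLite

open Nat.Partrec (Code)

/-! ### Horn rules, halting query and ontology -/

/-- The Horn rule `body → head`, written as the query that holds where the rule is violated. -/
def CQ.rule (body : List Atom) (head : Atom) : CQ := ⟨body, [head]⟩

/-- The role name that stands for the graph of the partial function computed by a code. -/
def graphRole (c : Code) : ℕ := Encodable.encode c + 5

/-- Horn rules that define, from zero (concept `0`) and successor (role `1`), the two components of
`Nat.unpair` (roles `2` and `3`) and the strict order (role `4`). -/
def arithmeticRules : UCQ :=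
  [.rule [.binary 1 0 1] (.binary 4 0 1),
   .rule [.binary 4 0 1, .binary 1 1 2] (.binary 4 0 2),
   .rule [.unary 0 0] (.binary 2 0 0),
   .rule [.unary 0 0] (.binary 3 0 0),
   -- `Nat.pair` enumerates the shells `max a b = m` as (0,m), ..., (m-1,m), (m,0), ..., (m,m). Each
   -- pair of rules below is one kind of step from `p` to `p + 1`.
   .rule [.binary 2 0 2, .binary 3 0 3, .binary 1 0 1, .binary 1 2 4, .binary 4 4 3]
     (.binary 2 1 4),
   .rule [.binary 2 0 2, .binary 3 0 3, .binary 1 0 1, .binary 1 2 4, .binary 4 4 3]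
     (.binary 3 1 3),
   .rule [.binary 2 0 2, .binary 3 0 3, .binary 1 0 1, .binary 1 2 3, .unary 0 4]
     (.binary 2 1 3),
   .rule [.binary 2 0 2, .binary 3 0 3, .binary 1 0 1, .binary 1 2 3, .unary 0 4]
     (.binary 3 1 4),
   .rule [.binary 2 0 2, .binary 3 0 3, .binary 1 0 1, .binary 4 3 2, .binary 1 3 4]
     (.binary 2 1 2),
   .rule [.binary 2 0 2, .binary 3 0 3, .binary 1 0 1, .binary 4 3 2, .binary 1 3 4]
     (.binary 3 1 4),
   .rule [.binary 2 0 2, .binary 3 0 2, .binary 1 0 1, .binary 1 2 4, .unary 0 3]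
     (.binary 2 1 3),
   .rule [.binary 2 0 2, .binary 3 0 2, .binary 1 0 1, .binary 1 2 4, .unary 0 3]
     (.binary 3 1 4)]

/-- Horn rules that define the graphs of the partial functions computed by a code and its
subcodes. -/
def codeRules : Code → UCQ
  -- The successor atom only makes variable 0 safe.
  | .zero => [.rule [.binary 1 0 1, .unary 0 2] (.binary (graphRole .zero) 0 2)]
  | .succ => [.rule [.binary 1 0 1] (.binary (graphRole .succ) 0 1)]
  | .left => [.rule [.binary 2 0 1] (.binary (graphRole .left) 0 1)]
  | .right => [.rule [.binary 3 0 1] (.binary (graphRole .right) 0 1)]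
  | .pair f g => codeRules f ++ codeRules g ++
      [.rule [.binary (graphRole f) 0 1, .binary (graphRole g) 0 2, .binary 2 3 1, .binary 3 3 2]
        (.binary (graphRole (.pair f g)) 0 3)]
  | .comp f g => codeRules f ++ codeRules g ++
      [.rule [.binary (graphRole g) 0 1, .binary (graphRole f) 1 2]
        (.binary (graphRole (.comp f g)) 0 2)]
  | .prec f g => codeRules f ++ codeRules g ++
      [.rule [.binary 2 0 1, .binary 3 0 2, .unary 0 2, .binary (graphRole f) 1 3]
        (.binary (graphRole (.prec f g)) 0 3),
       .rule [.binary 2 0 1, .binary 3 0 2, .binary 1 3 2, .binary 2 4 1, .binary 3 4 3,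
          .binary (graphRole (.prec f g)) 4 5, .binary 2 6 3, .binary 3 6 5, .binary 2 7 1,
          .binary 3 7 6, .binary (graphRole g) 7 8]
        (.binary (graphRole (.prec f g)) 0 8)]
  | .rfind' f => codeRules f ++
      [.rule [.binary (graphRole f) 0 1, .unary 0 1, .binary 3 0 2]
        (.binary (graphRole (.rfind' f)) 0 2),
       -- A nonzero value is recognised positively, by its predecessor (variable 2), so the rule
       -- stays Horn.
       .rule [.binary (graphRole f) 0 1, .binary 1 2 1, .binary 2 0 3, .binary 3 0 4,
          .binary 1 4 5, .binary 2 6 3, .binary 3 6 5, .binary (graphRole (.rfind' f)) 6 7]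
        (.binary (graphRole (.rfind' f)) 0 7)]

/-- The query that asks whether the code `c` halts on input `n`. -/
def haltingQuery (c : Code) (n : ℕ) : CQ :=
  -- Variables 0 to `n` spell out the input as a path from zero; variable `n + 1` is the output.
  ⟨.unary 0 0 :: .binary (graphRole c) n (n + 1) ::
    (List.range n).map fun i => .binary 1 i (i + 1), []⟩

/-- The union of queries that is entailed by `numberOntology` exactly if `c` halts on `n`. -/
def haltingUCQ (c : Code) (n : ℕ) : UCQ :=
  haltingQuery c n :: (arithmeticRules ++ codeRules c)

/-- The ontology that generates an infinite successor chain. Its start is linked to the only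
constant by role `0`, and the constant is marked by concept `1`. -/
def numberOntology : Ontology where
  tbox := [.sub (.name 1) (.ex (.name 0)), .sub (.ex (.inv 0)) (.name 0),
    .sub (.name 0) (.ex (.name 1)), .sub (.ex (.inv 1)) (.ex (.name 1))]
  abox := [.unary 1 0]

/-! ### Facts on pairing and on evaluation of codes -/

theorem pair_succ_of_lt {a b : ℕ} (h : a + 1 < b) :
    Nat.pair (a + 1) b = Nat.pair a b + 1 := by
  rw [Nat.pair, Nat.pair, if_pos h, if_pos (by omega)]; omega

theorem pair_zero_of_succ (a : ℕ) : Nat.pair (a + 1) 0 = Nat.pair a (a + 1) + 1 := by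
  rw [Nat.pair, Nat.pair, if_neg (by omega), if_pos (by omega)]; omega

theorem pair_succ_right_of_lt {a b : ℕ} (h : b < a) :
    Nat.pair a (b + 1) = Nat.pair a b + 1 := by
  rw [Nat.pair, Nat.pair, if_neg (by omega), if_neg (by omega)]; omega

theorem pair_zero_succ (a : ℕ) : Nat.pair 0 (a + 1) = Nat.pair a a + 1 := by
  rw [Nat.pair, Nat.pair, if_pos (by omega), if_neg (by omega)]; ring

theorem eq_pair_of_unpair {p a b : ℕ} (ha : p.unpair.1 = a) (hb : p.unpair.2 = b) :
    p = Nat.pair a b := by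
  rw [← ha, ← hb, Nat.pair_unpair]

/-- The search starts at `m` and returns the absolute position of the zero, not the offset `n`.
Hence restarting it at `m + 1` does not change the result. -/
theorem mem_eval_rfind' {f : Code} {a m y : ℕ} :
    y ∈ (Code.rfind' f).eval (Nat.pair a m) ↔ ∃ n, y = n + m ∧
      0 ∈ f.eval (Nat.pair a (n + m)) ∧ ∀ j < n, ∃ k, k + 1 ∈ f.eval (Nat.pair a (j + m)) := by
  have aux (x : ℕ) : false ∈ (f.eval x).map (fun m => decide (m = 0)) ↔
      ∃ k, k + 1 ∈ f.eval x := by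
    simp only [Part.mem_map_iff, decide_eq_false_iff_not]
    constructor
    · rintro ⟨_ | k, hk, h⟩
      · simp at h
      · exact ⟨k, hk⟩
    · rintro ⟨k, hk⟩
      exact ⟨k + 1, hk, by simp⟩
  have hrf (n : ℕ) :
      n ∈ Nat.rfind (fun n => (f.eval (Nat.pair a (n + m))).map fun m => decide (m = 0)) ↔
      0 ∈ f.eval (Nat.pair a (n + m)) ∧ ∀ j < n, ∃ k, k + 1 ∈ f.eval (Nat.pair a (j + m)) := by
    refine Nat.mem_rfind.trans (and_congr ?_ (forall₂_congr fun j _ => aux _))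
    rw [Part.mem_map_iff]
    simp
  have heval : (Code.rfind' f).eval (Nat.pair a m) =
      (Nat.rfind fun n => (f.eval (Nat.pair a (n + m))).map fun m => decide (m = 0)).map
        (· + m) := by
    simp [Code.eval, Nat.unpaired]
  rw [heval, Part.mem_map_iff]
  simp only [hrf]
  grind

theorem mem_eval_rfind'_step {f : Code} {a m y k : ℕ} (hk : k + 1 ∈ f.eval (Nat.pair a m))
    (hy : y ∈ (Code.rfind' f).eval (Nat.pair a (m + 1))) :
    y ∈ (Code.rfind' f).eval (Nat.pair a m) := by
  rw [mem_eval_rfind'] at hy ⊢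
  obtain ⟨n, rfl, h0, h⟩ := hy
  refine ⟨n + 1, by omega, by rwa [add_assoc, add_comm 1 m], fun j hj => ?_⟩
  rcases j with _ | j
  · exact ⟨k, by simpa using hk⟩
  · obtain ⟨i, hi⟩ := h j (by omega)
    exact ⟨i, by rwa [add_assoc, add_comm 1 m]⟩

/-! ### The standard model -/

/-- The interpretation of the role names on the natural numbers. -/
def natRel : ℕ → ℕ → ℕ → Prop
  | 0, _, _ => False
  | 1, x, y => y = x + 1
  | 2, x, y => x.unpair.1 = y
  | 3, x, y => x.unpair.2 = y
  | 4, x, y => x < y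
  | k + 5, x, y => y ∈ (Denumerable.ofNat Code k).eval x

theorem natRel_graphRole {c : Code} {x y : ℕ} : natRel (graphRole c) x y ↔ y ∈ c.eval x := by
  simp [graphRole, natRel]

/-- The natural numbers as a structure. -/
def natInterp : Interp where
  Dom := ℕ
  const _ := 0
  conc A x := A = 0 ∧ x = 0
  rel := natRel

section

variable {v : ℕ → ℕ} {t u : ℕ}

theorem natInterp_satAtom_zero : natInterp.SatAtom v (.unary 0 t) ↔ v t = 0 := by
  simp [Interp.SatAtom, natInterp]

theorem natInterp_satAtom_succ : natInterp.SatAtom v (.binary 1 t u) ↔ v u = v t + 1 := .rfl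

theorem natInterp_satAtom_fst : natInterp.SatAtom v (.binary 2 t u) ↔ (v t).unpair.1 = v u := .rfl

theorem natInterp_satAtom_snd : natInterp.SatAtom v (.binary 3 t u) ↔ (v t).unpair.2 = v u := .rfl

theorem natInterp_satAtom_lt : natInterp.SatAtom v (.binary 4 t u) ↔ v t < v u := .rfl

theorem natInterp_satAtom_graphRole {c : Code} :
    natInterp.SatAtom v (.binary (graphRole c) t u) ↔ v u ∈ c.eval (v t) :=
  natRel_graphRole

end

/-- The natural numbers together with an additional element that interprets the constants. -/
def pointedInterp : Interp where
  Dom := Option ℕ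
  const _ := none
  conc A s := (A = 1 ∧ s = none) ∨ (A = 0 ∧ s = some 0)
  rel P s t := (P = 0 ∧ s = none ∧ t = some 0) ∨ ∃ a b, s = some a ∧ t = some b ∧ natRel P a b

theorem pointedInterp_isModel (una pcwa : Bool) :
    pointedInterp.IsModel una pcwa numberOntology := by
  refine ⟨⟨?_, ?_⟩, ?_, ?_⟩
  · simp only [numberOntology, List.forall_mem_cons, List.not_mem_nil, false_imp_iff,
      implies_true, and_true, Interp.SatInclusion, Interp.basic, Interp.role, pointedInterp]
    refine ⟨?_, ?_, ?_, ?_⟩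
    · rintro s (⟨-, rfl⟩ | ⟨h, -⟩)
      · exact ⟨some 0, by simp⟩
      · simp at h
    · rintro s ⟨t, ⟨-, -, rfl⟩ | ⟨a, b, -, -, h⟩⟩
      · simp
      · exact h.elim
    · rintro s (⟨h, -⟩ | ⟨-, rfl⟩)
      · simp at h
      · exact ⟨some 1, by simp [natRel]⟩
    · rintro s ⟨t, ⟨h, -⟩ | ⟨a, b, -, rfl, h⟩⟩
      · simp at h
      · exact ⟨some (b + 1), by simp [natRel]⟩
  · simp [numberOntology, Interp.SatAtom, pointedInterp]
  · intro _ c d hc hd _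
    simp only [numberOntology, Ontology.Mentions, Atom.terms, List.mem_singleton,
      exists_eq_left] at hc hd
    rw [hc, hd]
  · rintro _ (⟨A, t⟩ | ⟨P, t, u⟩) hm h
    · simp_all [numberOntology, Ontology.Mentions, Atom.terms, Interp.SatAtom, pointedInterp]
    · simp [Interp.SatAtom, pointedInterp] at h

/-- The query is safe, it does not use role `0` or concept `1` in its positive part, and it is
false in the natural numbers. -/
def CQ.RefutedByNat (q : CQ) : Prop :=
  q.Safe ∧ (∀ α ∈ q.pos, ∀ t u, α ≠ .binary 0 t u ∧ α ≠ .unary 1 t) ∧ ¬ natInterp.SatCQ q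

/-- Without role `0` and concept `1`, positive atoms can match only inside the copy of ℕ. Safety
puts the variables of negated atoms there too, so a match is already one in ℕ. -/
theorem CQ.RefutedByNat.not_satCQ {q : CQ} (hq : q.RefutedByNat) :
    ¬ pointedInterp.SatCQ q := by
  obtain ⟨hs, hr, hn⟩ := hq
  rintro ⟨v, hpos, hneg⟩
  have key : ∀ α ∈ q.pos, (∀ x ∈ α.terms, ∃ a, v x = some a) ∧
      -- The default 0 affects only variables absent from the query.
      natInterp.SatAtom (fun x => (v x).getD 0) α := by
    rintro (⟨A, t⟩ | ⟨P, t, u⟩) hα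
    · rcases hpos _ hα with ⟨rfl, -⟩ | ⟨rfl, h⟩
      · exact absurd rfl (hr _ hα t 0).2
      · exact ⟨by simpa [Atom.terms] using ⟨0, h⟩,
          by simp [Interp.SatAtom, natInterp, h]⟩
    · rcases hpos _ hα with ⟨rfl, -⟩ | ⟨a, b, ha, hb, h⟩
      · exact absurd rfl (hr _ hα t u).1
      · exact ⟨by simpa [Atom.terms] using ⟨⟨a, ha⟩, b, hb⟩,
          by simp [Interp.SatAtom, natInterp, ha, hb, h]⟩
  refine hn ⟨_, fun α hα => (key α hα).2, fun α hα h => hneg α hα ?_⟩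
  have hv : ∀ x ∈ α.terms, ∃ a, v x = some a := fun x hx =>
    let ⟨β, hβ, hx'⟩ := hs α hα x hx
    (key β hβ).1 x hx'
  rcases α with ⟨A, t⟩ | ⟨P, t, u⟩
  · obtain ⟨a, ha⟩ := hv t (by simp [Atom.terms])
    simp only [Interp.SatAtom, natInterp, ha, Option.getD_some] at h
    exact Or.inr ⟨h.1, by rw [ha, h.2]⟩
  · obtain ⟨a, ha⟩ := hv t (by simp [Atom.terms])
    obtain ⟨b, hb⟩ := hv u (by simp [Atom.terms])
    simp only [Interp.SatAtom, natInterp, ha, hb, Option.getD_some] at h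
    exact Or.inr ⟨a, b, ha, hb, h⟩

theorem not_satCQ_rule {D : Interp} {body : List Atom} {head : Atom} :
    ¬ D.SatCQ (.rule body head) ↔
      ∀ v, (∀ α ∈ body, D.SatAtom v α) → D.SatAtom v head := by
  simp [Interp.SatCQ, CQ.rule]

theorem refutedByNat_rule {body : List Atom} {head : Atom} (hs : (CQ.rule body head).Safe)
    (hr : ∀ α ∈ body, ∀ t u, α ≠ .binary 0 t u ∧ α ≠ .unary 1 t)
    (h : ∀ v : ℕ → ℕ, (∀ α ∈ body, natInterp.SatAtom v α) →
      natInterp.SatAtom v head) :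
    (CQ.rule body head).RefutedByNat :=
  ⟨hs, hr, not_satCQ_rule.2 h⟩

theorem refutedByNat_arithmeticRules : ∀ q ∈ arithmeticRules, q.RefutedByNat := by
  have hpair {p a b p' a' b' : ℕ} (ha : p.unpair.1 = a) (hb : p.unpair.2 = b) (hp : p' = p + 1)
      (h : Nat.pair a' b' = Nat.pair a b + 1) : p'.unpair = (a', b') := by
    rw [hp, eq_pair_of_unpair ha hb, ← h, Nat.unpair_pair]
  simp only [arithmeticRules, List.forall_mem_cons, List.not_mem_nil, false_imp_iff,
    implies_true, and_true]
  refine ⟨?_, ?_, ?_, ?_, ?_, ?_, ?_, ?_, ?_, ?_, ?_, ?_⟩ <;>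
    refine refutedByNat_rule (by simp [CQ.Safe, CQ.rule, Atom.terms]) (by simp) fun v => ?_ <;>
    simp only [List.forall_mem_cons, List.not_mem_nil, false_imp_iff, implies_true, and_true,
      natInterp_satAtom_zero, natInterp_satAtom_succ, natInterp_satAtom_fst,
      natInterp_satAtom_snd, natInterp_satAtom_lt]
  · omega
  · omega
  · intro h; simp [h]
  · intro h; simp [h]
  · rintro ⟨h1, h2, h3, h4, h5⟩
    rw [hpair h1 h2 h3 (pair_succ_of_lt (h4 ▸ h5)), h4]
  · rintro ⟨h1, h2, h3, h4, h5⟩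
    rw [hpair h1 h2 h3 (pair_succ_of_lt (h4 ▸ h5))]
  · rintro ⟨h1, h2, h3, h4, h5⟩
    rw [hpair h1 (h2.trans h4) h3 (pair_zero_of_succ _), h4]
  · rintro ⟨h1, h2, h3, h4, h5⟩
    rw [hpair h1 (h2.trans h4) h3 (pair_zero_of_succ _), h5]
  · rintro ⟨h1, h2, h3, h4, h5⟩
    rw [hpair h1 h2 h3 (pair_succ_right_of_lt h4)]
  · rintro ⟨h1, h2, h3, h4, h5⟩
    rw [hpair h1 h2 h3 (pair_succ_right_of_lt h4), h5]
  · rintro ⟨h1, h2, h3, h4, h5⟩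
    rw [hpair h1 h2 h3 (pair_zero_succ _), h5]
  · rintro ⟨h1, h2, h3, h4, h5⟩
    rw [hpair h1 h2 h3 (pair_zero_succ _), h4]

theorem refutedByNat_codeRules (c : Code) : ∀ q ∈ codeRules c, q.RefutedByNat := by
  have hg (c : Code) : graphRole c ≠ 0 := by simp [graphRole]
  induction c <;> rw [codeRules] <;>
    simp only [List.forall_mem_append, List.forall_mem_cons, List.not_mem_nil, false_imp_iff,
      implies_true, and_true]
  case' rfind' f hf => refine ⟨hf, ?_, ?_⟩
  case' prec f g hf hg' => refine ⟨⟨hf, hg'⟩, ?_, ?_⟩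
  case' comp f g hf hg' => refine ⟨⟨hf, hg'⟩, ?_⟩
  case' pair f g hf hg' => refine ⟨⟨hf, hg'⟩, ?_⟩
  all_goals
    refine refutedByNat_rule (by simp [CQ.Safe, CQ.rule, Atom.terms]) (by simp [hg]) fun v => ?_
    simp only [List.forall_mem_cons, List.not_mem_nil, false_imp_iff, implies_true, and_true,
      natInterp_satAtom_zero, natInterp_satAtom_succ, natInterp_satAtom_fst,
      natInterp_satAtom_snd, natInterp_satAtom_graphRole]
  -- Order of the cases: `pair`, `comp`, `prec` (base, step), `rfind'` (stop, continue), `zero`,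
  -- `succ`, `left`, `right`.
  · rintro ⟨h1, h2, h3, h4⟩
    simp only [Code.eval, Seq.seq, Part.map_eq_map, Part.mem_bind_iff, Part.mem_map_iff]
    refine ⟨_, ⟨_, h1, rfl⟩, _, h2, (eq_pair_of_unpair h3 h4).symm⟩
  · rintro ⟨h1, h2⟩
    exact Part.mem_bind_iff.2 ⟨_, h1, h2⟩
  · rintro ⟨h1, h2, h3, h4⟩
    rw [eq_pair_of_unpair h1 h2, h3, Code.eval_prec_zero]
    exact h4
  · rintro ⟨h1, h2, h3, h4, h5, h6, h7, h8, h9, h10, h11⟩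
    rw [eq_pair_of_unpair h1 h2, h3, Code.eval_prec_succ]
    simp only [Part.bind_eq_bind, Part.mem_bind_iff]
    refine ⟨v 5, ?_, ?_⟩
    · rwa [← eq_pair_of_unpair h4 h5]
    · rwa [← eq_pair_of_unpair h7 h8, ← eq_pair_of_unpair h9 h10]
  · rintro ⟨h1, h2, h3⟩
    rw [eq_pair_of_unpair rfl h3, h2] at h1
    rw [eq_pair_of_unpair rfl h3]
    exact mem_eval_rfind'.2 ⟨0, by simp, by simpa using h1, by simp⟩
  · rintro ⟨h1, h2, h3, h4, h5, h6, h7, h8⟩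
    rw [eq_pair_of_unpair h3 h4] at h1 ⊢
    rw [eq_pair_of_unpair h6 h7, h5] at h8
    exact mem_eval_rfind'_step (h2 ▸ h1) h8
  · rintro ⟨-, h⟩; simp [Code.eval, h, pure, PFun.pure]
  · intro h; simp [Code.eval, h]
  · intro h; simp [Code.eval, h]
  · intro h; simp [Code.eval, h]

theorem refutedByNat_haltingQuery {c : Code} {n : ℕ} (h : ¬ (c.eval n).Dom) :
    (haltingQuery c n).RefutedByNat := by
  refine ⟨by simp [CQ.Safe, haltingQuery], ?_, ?_⟩
  · simp [haltingQuery, graphRole]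
  · rintro ⟨v, hv, -⟩
    change ℕ → ℕ at v
    simp only [haltingQuery, List.forall_mem_cons, List.forall_mem_map, List.mem_range,
      natInterp_satAtom_zero, natInterp_satAtom_succ, natInterp_satAtom_graphRole] at hv
    obtain ⟨h0, h1, h2⟩ := hv
    have hid : ∀ i ≤ n, v i = i := by
      intro i hi
      induction i with
      | zero => exact h0
      | succ i ih => rw [h2 i hi, ih (by omega)]
    rw [hid n le_rfl] at h1
    exact h (Part.dom_iff_mem.2 ⟨_, h1⟩)

theorem haltingUCQ_safe (c : Code) (n : ℕ) : (haltingUCQ c n).Safe := by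
  intro q hq
  simp only [haltingUCQ, List.mem_cons, List.mem_append] at hq
  rcases hq with rfl | hq | hq
  · simp [CQ.Safe, haltingQuery]
  · exact (refutedByNat_arithmeticRules q hq).1
  · exact (refutedByNat_codeRules c q hq).1

/-! ### Numbers in arbitrary models -/

/-- A map from the natural numbers that respects zero and successor. -/
structure Interp.IsNumbering (D : Interp) (e : ℕ → D.Dom) : Prop where
  zero : D.conc 0 (e 0)
  succ : ∀ n, D.rel 1 (e n) (e (n + 1))

/-- Successors are chosen one after another. The chain may run into a cycle; injectivity is not
needed. -/
theorem Interp.SatOntology.exists_isNumbering {D : Interp} (h : D.SatOntology numberOntology) :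
    ∃ e, D.IsNumbering e := by
  obtain ⟨ht, ha⟩ := h
  simp only [numberOntology, List.forall_mem_cons, List.not_mem_nil, false_imp_iff,
    implies_true, and_true, Interp.SatInclusion, Interp.basic, Interp.role, Interp.SatAtom]
    at ht ha
  obtain ⟨h1, h2, h3, h4⟩ := ht
  obtain ⟨z, hz⟩ := h1 _ ha
  have hz0 : D.conc 0 z := h2 z ⟨_, hz⟩
  choose! s hs using h4
  have hz' : ∃ t, D.rel 1 z t := h3 z hz0
  obtain ⟨t, ht⟩ := hz'
  -- `s` yields successors only of elements with a predecessor, so the first step from `z` uses `t`.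
  let e : ℕ → D.Dom := fun n => Nat.casesOn n z fun n => s^[n] t
  refine ⟨e, hz0, fun n => ?_⟩
  induction n with
  | zero => exact ht
  | succ n ih =>
    have : e (n + 2) = s (e (n + 1)) := Function.iterate_succ_apply' s n t
    rw [this]
    exact hs _ ⟨_, ih⟩

namespace Interp.IsNumbering

variable {D : Interp} {e : ℕ → D.Dom}

/-- Lets a rule be applied by listing the numbers assigned to its variables in order. -/
theorem sat_head {body : List Atom} {head : Atom} (h : ¬ D.SatCQ (.rule body head))
    (l : List ℕ) (hb : ∀ α ∈ body, D.SatAtom (fun i => e (l.getD i 0)) α) :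
    D.SatAtom (fun i => e (l.getD i 0)) head :=
  not_satCQ_rule.1 h _ hb

theorem rel_lt (he : D.IsNumbering e) (h : ∀ q ∈ arithmeticRules, ¬ D.SatCQ q) {a b : ℕ}
    (hab : a < b) : D.rel 4 (e a) (e b) := by
  simp only [arithmeticRules, List.forall_mem_cons] at h
  obtain ⟨h1, h2, -⟩ := h
  induction b, hab using Nat.le_induction with
  | base => exact sat_head h1 [a, a + 1] (by simpa [SatAtom] using he.succ a)
  | succ b _ ih =>
    exact sat_head h2 [a, b, b + 1] (by simpa [SatAtom] using ⟨ih, he.succ b⟩)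

theorem rel_pair (he : D.IsNumbering e) (h : ∀ q ∈ arithmeticRules, ¬ D.SatCQ q) (p : ℕ) :
    ∀ a b, p = Nat.pair a b → D.rel 2 (e p) (e a) ∧ D.rel 3 (e p) (e b) := by
  have hlt {a b : ℕ} (hab : a < b) := he.rel_lt h hab
  simp only [arithmeticRules, List.forall_mem_cons] at h
  obtain ⟨-, -, z1, z2, p1, p2, p3, p4, p5, p6, p7, p8, -⟩ := h
  suffices H : D.rel 2 (e p) (e p.unpair.1) ∧ D.rel 3 (e p) (e p.unpair.2) by
    rintro a b rfl
    simpa using H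
  induction p with
  | zero =>
    exact ⟨sat_head z1 [0] (by simpa [SatAtom] using he.zero),
      sat_head z2 [0] (by simpa [SatAtom] using he.zero)⟩
  | succ p ih =>
    have hp := Nat.pair_unpair p
    generalize p.unpair.1 = a, p.unpair.2 = b at hp ih
    obtain ⟨ih1, ih2⟩ := ih
    have hs := he.succ
    have hz := he.zero
    rcases lt_trichotomy a b with hab | rfl | hab
    -- If `b = a + 1`, the first half of the shell is exhausted and the next pair is `(b, 0)`.
    · rcases eq_or_lt_of_le (Nat.succ_le_of_lt hab) with rfl | hab'
      · rw [← hp, ← pair_zero_of_succ, Nat.unpair_pair, pair_zero_of_succ, hp]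
        exact ⟨sat_head p3 [p, p + 1, a, a + 1, 0] (by simp [SatAtom, *]),
          sat_head p4 [p, p + 1, a, a + 1, 0] (by simp [SatAtom, *])⟩
      · rw [← hp, ← pair_succ_of_lt hab', Nat.unpair_pair, pair_succ_of_lt hab', hp]
        have := hlt hab'
        exact ⟨sat_head p1 [p, p + 1, a, b, a + 1] (by simp [SatAtom, *]),
          sat_head p2 [p, p + 1, a, b, a + 1] (by simp [SatAtom, *])⟩
    · rw [← hp, ← pair_zero_succ, Nat.unpair_pair, pair_zero_succ, hp]
      exact ⟨sat_head p7 [p, p + 1, a, 0, a + 1] (by simp [SatAtom, *]),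
        sat_head p8 [p, p + 1, a, 0, a + 1] (by simp [SatAtom, *])⟩
    · rw [← hp, ← pair_succ_right_of_lt hab, Nat.unpair_pair, pair_succ_right_of_lt hab, hp]
      have := hlt hab
      exact ⟨sat_head p5 [p, p + 1, a, b, b + 1] (by simp [SatAtom, *]),
        sat_head p6 [p, p + 1, a, b, b + 1] (by simp [SatAtom, *])⟩

/-- Induction on the code: every finite computation is a derivation by the rules. Inside, `prec`
needs induction on the recursion argument and `rfind'` on the number of remaining search steps, with
varying start. -/
theorem rel_graphRole (he : D.IsNumbering e) (h : ∀ q ∈ arithmeticRules, ¬ D.SatCQ q)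
    (c : Code) (hc : ∀ q ∈ codeRules c, ¬ D.SatCQ q) (x y : ℕ) (hxy : y ∈ c.eval x) :
    D.rel (graphRole c) (e x) (e y) := by
  have hs := he.succ
  have hz := he.zero
  have hL (a b : ℕ) := (he.rel_pair h _ a b rfl).1
  have hR (a b : ℕ) := (he.rel_pair h _ a b rfl).2
  induction c generalizing x y <;> rw [codeRules] at hc <;>
    simp only [List.forall_mem_append, List.forall_mem_cons, List.not_mem_nil, false_imp_iff,
      implies_true, and_true] at hc
  case zero =>
    obtain rfl : y = 0 := by simpa [Code.eval, pure, PFun.pure] using hxy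
    exact sat_head hc [x, x + 1, 0] (by simp [SatAtom, *])
  case succ =>
    obtain rfl : y = x + 1 := by simpa [Code.eval] using hxy
    exact sat_head hc [x, x + 1] (by simp [SatAtom, *])
  case left =>
    obtain rfl : y = x.unpair.1 := by simpa [Code.eval] using hxy
    have := hL x.unpair.1 x.unpair.2
    rw [Nat.pair_unpair] at this
    exact sat_head hc [x, x.unpair.1] (by simp [SatAtom, *])
  case right =>
    obtain rfl : y = x.unpair.2 := by simpa [Code.eval] using hxy
    have := hR x.unpair.1 x.unpair.2
    rw [Nat.pair_unpair] at this
    exact sat_head hc [x, x.unpair.2] (by simp [SatAtom, *])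
  case pair f g ihf ihg =>
    simp only [Code.eval, Seq.seq, Part.map_eq_map, Part.mem_bind_iff, Part.mem_map_iff] at hxy
    obtain ⟨_, ⟨a, ha, rfl⟩, b, hb, rfl⟩ := hxy
    have := ihf hc.1.1 _ _ ha
    have := ihg hc.1.2 _ _ hb
    exact sat_head hc.2 [x, a, b, Nat.pair a b] (by simp [SatAtom, *])
  case comp f g ihf ihg =>
    obtain ⟨z, hz', hy⟩ := Part.mem_bind_iff.1 hxy
    have := ihg hc.1.2 _ _ hz'
    have := ihf hc.1.1 _ _ hy
    exact sat_head hc.2 [x, z, y] (by simp [SatAtom, *])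
  case prec f g ihf ihg =>
    obtain ⟨⟨hf, hg⟩, h0, h1⟩ := hc
    obtain ⟨a, n, rfl⟩ : ∃ a n, x = Nat.pair a n := ⟨_, _, (Nat.pair_unpair x).symm⟩
    induction n generalizing y with
    | zero =>
      rw [Code.eval_prec_zero] at hxy
      have := ihf hf _ _ hxy
      exact sat_head h0 [Nat.pair a 0, a, 0, y] (by simp [SatAtom, *])
    | succ n ih =>
      rw [Code.eval_prec_succ] at hxy
      simp only [Part.bind_eq_bind, Part.mem_bind_iff] at hxy
      obtain ⟨i, hi, hy⟩ := hxy
      have := ih _ hi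
      have := ihg hg _ _ hy
      exact sat_head h1 [Nat.pair a (n + 1), a, n + 1, n, Nat.pair a n, i, Nat.pair n i,
        Nat.pair a (Nat.pair n i), y] (by simp [SatAtom, *])
  case rfind' f ihf =>
    obtain ⟨hf, h0, h1⟩ := hc
    obtain ⟨a, m, rfl⟩ : ∃ a m, x = Nat.pair a m := ⟨_, _, (Nat.pair_unpair x).symm⟩
    obtain ⟨n, rfl, hn0, hn⟩ := mem_eval_rfind'.1 hxy
    clear hxy
    induction n generalizing m with
    | zero =>
      rw [zero_add] at hn0 ⊢
      have := ihf hf _ _ hn0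
      exact sat_head h0 [Nat.pair a m, 0, m] (by simp [SatAtom, *])
    | succ n ih =>
      have hstep (j : ℕ) : j + 1 + m = j + (m + 1) := by omega
      obtain ⟨k, hk⟩ := hn 0 (by omega)
      rw [zero_add] at hk
      have := ihf hf _ _ hk
      have := ih (m + 1) (hstep n ▸ hn0) fun j hj => hstep j ▸ hn (j + 1) (by omega)
      rw [hstep]
      exact sat_head h1 [Nat.pair a m, k + 1, k, a, m, m + 1, Nat.pair a (m + 1), n + (m + 1)]
        (by simp [SatAtom, *])

end Interp.IsNumbering

/-! ### The reduction -/

theorem entails_haltingUCQ_iff (una pcwa : Bool) (c : Code) (n : ℕ) :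
    Entails una pcwa numberOntology (haltingUCQ c n) ↔ (c.eval n).Dom := by
  constructor
  · intro h
    by_contra hn
    obtain ⟨q, hq, hsat⟩ := h _ (pointedInterp_isModel una pcwa)
    refine CQ.RefutedByNat.not_satCQ ?_ hsat
    simp only [haltingUCQ, List.mem_cons, List.mem_append] at hq
    rcases hq with rfl | hq | hq
    · exact refutedByNat_haltingQuery hn
    · exact refutedByNat_arithmeticRules q hq
    · exact refutedByNat_codeRules c q hq
  · intro h D hD
    by_contra hsat
    simp only [Interp.SatUCQ, haltingUCQ, not_exists, not_and, List.forall_mem_cons,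
      List.forall_mem_append] at hsat
    obtain ⟨hq, ha, hc⟩ := hsat
    obtain ⟨e, he⟩ := hD.1.exists_isNumbering
    obtain ⟨y, hy⟩ := Part.dom_iff_mem.1 h
    have hy' := he.rel_graphRole ha c hc n y hy
    refine hq ⟨fun i => if i ≤ n then e i else e y, ?_, by simp [haltingQuery]⟩
    simp only [haltingQuery, List.forall_mem_cons, List.forall_mem_map, List.mem_range,
      Interp.SatAtom]
    refine ⟨by simpa using he.zero, by simpa using hy', fun i hi => ?_⟩
    rw [if_pos hi.le, if_pos (Nat.succ_le_of_lt hi)]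
    exact he.succ i

/-! ### Computability of the reduction -/

theorem primrec_atom_unary : Primrec₂ Atom.unary :=
  (Primrec.of_equiv_symm (e := Atom.equiv)).comp Primrec.sumInl

theorem primrec_atom_binary : Primrec fun p : ℕ × ℕ × ℕ => Atom.binary p.1 p.2.1 p.2.2 :=
  (Primrec.of_equiv_symm (e := Atom.equiv)).comp Primrec.sumInr

theorem primrec_cq_mk : Primrec₂ CQ.mk :=
  Primrec.of_equiv_symm (e := CQ.equiv)

/-- As `c` is fixed, the rules form a constant list; only the halting query depends on the input. -/
theorem primrec_haltingUCQ (c : Code) : Primrec (haltingUCQ c) := by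
  have hbin {α : Type} [Primcodable α] (P : ℕ) {f g : α → ℕ} (hf : Primrec f) (hg : Primrec g) :
      Primrec fun a => Atom.binary P (f a) (g a) :=
    primrec_atom_binary.comp (.pair (.const P) (.pair hf hg))
  refine Primrec.list_cons.comp (primrec_cq_mk.comp ?_ (.const [])) (.const _)
  refine Primrec.list_cons.comp (.const _) (Primrec.list_cons.comp ?_ ?_)
  · exact hbin _ .id .succ
  · exact Primrec.list_map Primrec.list_range (hbin _ Primrec.snd (Primrec.succ.comp Primrec.snd))

/-- A code that halts on exactly those inputs that encode a code which halts on `0`. -/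
theorem exists_code_halting :
    ∃ u : Code, ∀ c : Code, (u.eval (Encodable.encode c)).Dom ↔ (c.eval 0).Dom := by
  have h : Partrec fun n : ℕ => (Denumerable.ofNat Code n).eval 0 :=
    Code.eval_part.comp (Computable.ofNat Code) (.const 0)
  obtain ⟨u, hu⟩ := Code.exists_code.1 (Partrec.nat_iff.1 h)
  exact ⟨u, fun c => by rw [hu]; simp⟩

end DLLite

theorem theorem4 (una pcwa : Bool) :
    ¬ ∃ f : DLLite.Ontology × DLLite.UCQ → Bool, Computable f ∧
      ∀ (O : DLLite.Ontology) (Φ : DLLite.UCQ), Φ.Safe →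
        (f (O, Φ) = true ↔ DLLite.Entails una pcwa O Φ) := by
  rintro ⟨f, hf, h⟩
  obtain ⟨u, hu⟩ := DLLite.exists_code_halting
  -- The program to be tested enters only as the number given to the universal code `u`.
  refine ComputablePred.halting_problem 0 (ComputablePred.computable_iff.2
    ⟨fun c => f (DLLite.numberOntology, DLLite.haltingUCQ u (Encodable.encode c)),
      hf.comp (.pair (.const _)
        ((DLLite.primrec_haltingUCQ u).to_comp.comp Computable.encode)), ?_⟩)
  funext c
  rw [← hu c, ← DLLite.entails_haltingUCQ_iff una pcwa,
    ← h _ _ (DLLite.haltingUCQ_safe u _)]
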